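/- Let $X$ be a $\sigma$-compact topological space with its Borel $\sigma$-algebra, let $\lambda$ be a Borel probability measure on $X$, and let $f:X\to X$ be a measurable map for which $\lambda$ is quasi-invariant, i.e. $f_*\lambda\ll\lambda$. Assume that $f$ is ergodic with respect to $\lambda$ (every measurable $A$ with $f^{-1}(A)=A$ satisfies $\lambda(A)=0$ or $\lambda(X\setminus A)=0$) and conservative with respect to $\lambda$ (for every measurable $A$ with $\lambda(A)>0$ there are $x\in A$ and $n\ge1$ with $f^n(x)\in A$). A $\lambda$-partition of $X$ is a countable collection $\mathcal G$ of pairwise disjoint $\sigma$-compact Borel sets $I$ with $0<\lambda(I)<\infty$ and $\lambda\bigl(X\setminus\bigcup_{I\in\mathcal G}I\bigr)=0$. For such $\mathcal G$, let $\mathcal M(\mathcal G,f)$ be the set of $\sigma$-finite Borel measures $\mu$ on $X$ such that for every $I\in\mathcal G$ there is a $K>0$ with 1. $\frac1K\le\mu(I)\le K$; and 2. for every $n\ge0$, $0<\mu(f^{-n}(I))<\infty$, and for every measurable $A\subset I$ $$\frac1K\,\frac{\lambda(A)}{\lambda(I)}\le\frac{\mu(f^{-n}(A))}{\mu(f^{-n}(I))}\le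 K\,\frac{\lambda(A)}{\lambda(I)}.$$ **Theorem.** If there is a $\lambda$-partition $\mathcal G$ of $X$ with $\lambda\in\mathcal M(\mathcal G,f)$, then $f$ has a $\sigma$-finite absolutely continuous invariant measure: there is a nonzero $\sigma$-finite Borel measure $\nu$ on $X$ with $\nu\ll\lambda$ and $f_*\nu=\nu$. -/

import Mathlib

namespace Acim

open MeasureTheory

variable {X : Type*} [MeasurableSpace X]

/-- A `lam`-partition of `X`: a countable (finite or infinite) collection of pairwise disjoint
Borel sets, each `σ`-compact and of positive finite `lam`-measure, covering `X` up to a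
`lam`-null set. -/
structure IsLambdaPartition [TopologicalSpace X] (lam : Measure X) (G : Set (Set X)) : Prop where
  countable : G.Countable
  pairwiseDisjoint : ∀ I ∈ G, ∀ J ∈ G, I ≠ J → Disjoint I J
  measurableSet : ∀ I ∈ G, MeasurableSet I
  isSigmaCompact : ∀ I ∈ G, IsSigmaCompact I
  pos : ∀ I ∈ G, 0 < lam I
  lt_top : ∀ I ∈ G, lam I < ⊤
  null_compl : lam (⋃₀ G)ᶜ = 0

/-- The derivative of `mu` with respect to `lam` has distortion bounded by `K` on `I`
(used for sets `I` with `lam I` and `mu I` positive and finite). -/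
def DistortionBoundedBy (lam mu : Measure X) (I : Set X) (K : ℝ) : Prop :=
  ∀ A : Set X, MeasurableSet A → A ⊆ I →
    (1 / K) * (lam.real A / lam.real I) ≤ mu.real A / mu.real I ∧
      mu.real A / mu.real I ≤ K * (lam.real A / lam.real I)

/-- `mu I ∈ [1/K, K]`. -/
def CondM1 (mu : Measure X) (I : Set X) (K : ℝ) : Prop :=
  mu I ≠ ⊤ ∧ 1 / K ≤ mu.real I ∧ mu.real I ≤ K

/-- For every `n`, the set `f⁻ⁿ(I)` has positive finite `mu`-measure, and the derivative of
`fⁿ_* mu` with respect to `lam` has distortion bounded by `K` on `I`. -/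
def CondM2 (lam : Measure X) (f : X → X) (mu : Measure X) (I : Set X) (K : ℝ) : Prop :=
  ∀ n : ℕ, 0 < mu (f^[n] ⁻¹' I) ∧ mu (f^[n] ⁻¹' I) < ⊤ ∧
    DistortionBoundedBy lam (mu.map f^[n]) I K

/-- The space `𝓜(G, f)` of `σ`-finite measures `mu` such that, for every `I ∈ G`, the measures
`fⁿ_* mu` have uniformly (in `n`) bounded distortion on `I`. -/
def measureClass (lam : Measure X) (G : Set (Set X)) (f : X → X) : Set (Measure X) :=
  {mu | SigmaFinite mu ∧ ∀ I ∈ G, ∃ K : ℝ, 0 < K ∧ CondM1 mu I K ∧ CondM2 lam f mu I K}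

end Acim

/-!
Fix `I ∈ G` with `lam I ≠ 0`. For `t < 1` the discounted sum `S t = ∑ n, tⁿ • fⁿ_* lam` satisfies
`t • f_* (S t) ≤ S t`, and so does its normalization `m t = (S t I)⁻¹ • S t`. Take `nu` to be the
lower limit of `m t` along a sequence `t → 1`, in the complete lattice of measures: passing to the
limit in the inequality gives `f_* nu ≤ nu`. The lower half of the distortion bound, written as
`(c * m t J) • lam|_J ≤ m t`, is linear in the measures `fⁿ_* lam` and survives the limit. For
`J = I` it shows `nu ≠ 0`. For other `J`, almost every orbit hits `I`, so `B = J ∩ f⁻ᵏ(I)` has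
positive measure for some `k`, and `c * nu J * lam B ≤ nu B ≤ nu (f⁻ᵏ(I)) ≤ nu I ≤ 1` bounds `nu J`.
Finally, conservativity forces the defect `nu - f_* nu` to vanish: the masses that it gives to the
preimages `f⁻ⁿ(A)` sum to at most `nu A`.
-/

open MeasureTheory Filter Topology Set
open scoped ENNReal

namespace Acim

variable {X : Type*} [MeasurableSpace X] {lam mu nu : Measure X} {f : X → X} {I J A : Set X}
  {c t : ℝ≥0∞}

section MeasureLattice

theorem iSup_measure_apply_of_monotone {m : ℕ → Measure X} (hm : Monotone m)
    (hA : MeasurableSet A) : (⨆ n, m n) A = ⨆ n, m n A := by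
  let s : OuterMeasure X := ⨆ n, (m n).toOuterMeasure
  have hs : ∀ B, s B = ⨆ n, m n B := OuterMeasure.iSup_apply _
  have hcara : ‹MeasurableSpace X› ≤ s.caratheodory := fun B hB T => by
    simp only [hs]
    rw [ENNReal.iSup_add_iSup_of_monotone (fun i j hij => hm hij _) fun i j hij => hm hij _]
    exact iSup_congr fun n => (measure_inter_add_sdiff T hB).symm
  have hle : ⨆ n, m n ≤ s.toMeasure hcara := iSup_le fun n => Measure.le_iff.2 fun B hB => by
    rw [toMeasure_apply s hcara hB, hs]
    exact le_iSup (fun n => m n B) n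
  refine le_antisymm ((hle A).trans_eq ?_) (iSup_le fun n => le_iSup m n A)
  rw [toMeasure_apply s hcara hA, hs]

theorem liminf_measure_apply (m : ℕ → Measure X) (hA : MeasurableSet A) :
    liminf m atTop A = ⨆ N, (⨅ k ≥ N, m k) A := by
  rw [liminf_eq_iSup_iInf_of_nat]
  exact iSup_measure_apply_of_monotone
    (fun _ _ hNM => biInf_mono fun _ hk => hNM.trans hk) hA

theorem liminf_measure_apply_le (m : ℕ → Measure X) (hA : MeasurableSet A) :
    liminf m atTop A ≤ liminf (fun k => m k A) atTop := by
  rw [liminf_measure_apply m hA, liminf_eq_iSup_iInf_of_nat]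
  exact iSup_mono fun N => le_iInf₂ fun k hk => iInf₂_le (f := fun k _ => m k) k hk A

theorem liminf_measure_absolutelyContinuous {m : ℕ → Measure X} (h : ∀ k, m k ≪ lam) :
    liminf m atTop ≪ lam :=
  Measure.AbsolutelyContinuous.mk fun A hA h0 =>
    le_zero_iff.1 <| (liminf_measure_apply_le m hA).trans_eq <| by simp [fun k => h k h0]

theorem map_liminf_le (hf : Measurable f) {m : ℕ → Measure X} {t : ℕ → ℝ≥0∞}
    (ht : Tendsto t atTop (𝓝 1)) (h : ∀ k, t k • (m k).map f ≤ m k) :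
    (liminf m atTop).map f ≤ liminf m atTop := by
  refine Measure.le_iff.2 fun A hA => ?_
  rw [Measure.map_apply hf hA, liminf_measure_apply m (hf hA)]
  refine iSup_le fun N => ENNReal.le_of_forall_lt_one_mul_le fun s hs => ?_
  have hle : s • (⨅ k ≥ N, m k).map f ≤ liminf m atTop := by
    refine le_liminf_of_le (by isBoundedDefault) ?_
    filter_upwards [ht.eventually_const_le hs, eventually_ge_atTop N] with k hsk hk
    calc s • (⨅ k ≥ N, m k).map f ≤ t k • (m k).map f := by
          gcongr
          exact iInf₂_le (f := fun k _ => m k) k hk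
      _ ≤ m k := h k
  simpa [Measure.map_apply hf hA] using hle A

end MeasureLattice

section Distortion

/-- The lower half of `DistortionBoundedBy`, as an inequality of measures: `mu A / mu I` is at least
`c * lam A` for `A ⊆ I`. The mass of `I` under `lam` is absorbed into `c`, and nothing is divided,
so that the condition is also meaningful when `mu I` is `0` or `⊤`. -/
def DistortionBoundedBelow (lam mu : Measure X) (I : Set X) (c : ℝ≥0∞) : Prop :=
  (c * mu I) • lam.restrict I ≤ mu

theorem DistortionBoundedBy.distortionBoundedBelow [IsFiniteMeasure lam] [IsFiniteMeasure mu]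
    (hI : MeasurableSet I) {K : ℝ} (h : DistortionBoundedBy lam mu I K) :
    DistortionBoundedBelow lam mu I (ENNReal.ofReal (K * lam.real I)⁻¹) := by
  refine Measure.le_iff.2 fun A hA => ?_
  rcases eq_or_ne (mu I) 0 with hmu | hmu
  · simp [hmu]
  have hlow := (h (A ∩ I) (hA.inter hI) inter_subset_right).1
  have hmu_pos : 0 < mu.real I := ENNReal.toReal_pos hmu (measure_ne_top _ _)
  rw [le_div_iff₀ hmu_pos] at hlow
  calc ((ENNReal.ofReal (K * lam.real I)⁻¹ * mu I) • lam.restrict I) A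
      = ENNReal.ofReal ((1 / K) * (lam.real (A ∩ I) / lam.real I) * mu.real I) := by
        rw [Measure.smul_apply, smul_eq_mul, Measure.restrict_apply hA,
          ← ofReal_measureReal (μ := mu), ← ofReal_measureReal (μ := lam),
          ← ENNReal.ofReal_mul' measureReal_nonneg, ← ENNReal.ofReal_mul' measureReal_nonneg]
        congr 1
        ring
    _ ≤ ENNReal.ofReal (mu.real (A ∩ I)) := ENNReal.ofReal_le_ofReal hlow
    _ = mu (A ∩ I) := ofReal_measureReal
    _ ≤ mu A := measure_mono inter_subset_left

theorem CondM2.exists_distortionBoundedBelow [IsFiniteMeasure lam] [IsFiniteMeasure mu]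
    (hI : MeasurableSet I) (h0 : lam I ≠ 0) {K : ℝ} (hK : 0 < K) (h : CondM2 lam f mu I K) :
    ∃ c ≠ 0, ∀ n, DistortionBoundedBelow lam (mu.map f^[n]) I c := by
  have hlam_pos : 0 < lam.real I := ENNReal.toReal_pos h0 (measure_ne_top _ _)
  refine ⟨ENNReal.ofReal (K * lam.real I)⁻¹, ?_, fun n => (h n).2.2.distortionBoundedBelow hI⟩
  exact (ENNReal.ofReal_pos.2 (by positivity)).ne'

theorem DistortionBoundedBelow.smul (h : DistortionBoundedBelow lam mu I c) (a : ℝ≥0∞) :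
    DistortionBoundedBelow lam (a • mu) I c := by
  rw [DistortionBoundedBelow, Measure.smul_apply, smul_eq_mul, mul_left_comm, ← smul_smul]
  gcongr
  exact h

theorem DistortionBoundedBelow.sum {ι : Type*} {m : ι → Measure X} (hI : MeasurableSet I)
    (h : ∀ i, DistortionBoundedBelow lam (m i) I c) :
    DistortionBoundedBelow lam (Measure.sum m) I c := by
  refine Measure.le_iff.2 fun A hA => ?_
  rw [Measure.smul_apply, smul_eq_mul, Measure.sum_apply _ hI, Measure.sum_apply _ hA,
    ← ENNReal.tsum_mul_left, ← ENNReal.tsum_mul_right]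
  exact ENNReal.tsum_le_tsum fun i => h i A

theorem smul_restrict_le_liminf {m : ℕ → Measure X}
    (h : ∀ k, DistortionBoundedBelow lam (m k) I c) :
    (c * liminf (fun k => m k I) atTop) • lam.restrict I ≤ liminf m atTop := by
  refine Measure.le_iff.2 fun A _ => ?_
  rw [Measure.smul_apply, smul_eq_mul, liminf_eq_iSup_iInf_of_nat, ENNReal.mul_iSup,
    ENNReal.iSup_mul]
  refine iSup_le fun N => ?_
  have hle : (c * ⨅ k ≥ N, m k I) • lam.restrict I ≤ liminf m atTop := by
    refine le_liminf_of_le (by isBoundedDefault) ?_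
    filter_upwards [eventually_ge_atTop N] with k hk
    refine le_trans ?_ (h k)
    gcongr
    exact iInf₂_le k hk
  exact hle A

theorem DistortionBoundedBelow.liminf {m : ℕ → Measure X} (hI : MeasurableSet I)
    (h : ∀ k, DistortionBoundedBelow lam (m k) I c) :
    DistortionBoundedBelow lam (liminf m atTop) I c := by
  refine le_trans ?_ (smul_restrict_le_liminf h)
  gcongr
  exact liminf_measure_apply_le m hI

end Distortion

section Superinvariant

theorem measure_preimage_iterate_le (hf : Measurable f) (h : nu.map f ≤ nu)
    (hA : MeasurableSet A) (n : ℕ) : nu (f^[n] ⁻¹' A) ≤ nu A := by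
  induction n with
  | zero => rfl
  | succ n ih =>
    calc nu (f^[n + 1] ⁻¹' A) = nu.map f (f^[n] ⁻¹' A) := by
          rw [Measure.map_apply hf (hf.iterate n hA), Function.iterate_succ, preimage_comp]
      _ ≤ nu (f^[n] ⁻¹' A) := h _
      _ ≤ nu A := ih

theorem DistortionBoundedBelow.measure_ne_top (hf : Measurable f) (hle : nu.map f ≤ nu)
    (hdist : DistortionBoundedBelow lam nu J c) (hc : c ≠ 0) (hI : MeasurableSet I)
    (hnu : nu I ≠ ⊤) {k : ℕ} (hk : lam (f^[k] ⁻¹' I ∩ J) ≠ 0) : nu J ≠ ⊤ := by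
  have hbound : c * nu J * lam (f^[k] ⁻¹' I ∩ J) ≤ nu I :=
    calc c * nu J * lam (f^[k] ⁻¹' I ∩ J)
        = ((c * nu J) • lam.restrict J) (f^[k] ⁻¹' I) := by
          simp [Measure.restrict_apply (hf.iterate k hI)]
      _ ≤ nu (f^[k] ⁻¹' I) := hdist _
      _ ≤ nu I := measure_preimage_iterate_le hf hle hI k
  intro htop
  refine hnu (top_unique ?_)
  simpa [htop, ENNReal.mul_top hc, ENNReal.top_mul hk] using hbound

theorem exists_add_eq_of_le [SigmaFinite nu] (h : mu ≤ nu) : ∃ d : Measure X, mu + d = nu := by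
  have : SigmaFinite mu := Measure.sigmaFinite_of_le nu h
  refine ⟨nu.withDensity (1 - mu.rnDeriv nu), ?_⟩
  calc mu + nu.withDensity (1 - mu.rnDeriv nu)
      = nu.withDensity (mu.rnDeriv nu) + nu.withDensity (1 - mu.rnDeriv nu) := by
        rw [Measure.withDensity_rnDeriv_eq mu nu (Measure.absolutelyContinuous_of_le h)]
    _ = nu.withDensity (mu.rnDeriv nu + (1 - mu.rnDeriv nu)) :=
        (withDensity_add_left (Measure.measurable_rnDeriv mu nu) _).symm
    _ = nu.withDensity 1 := withDensity_congr_ae <| by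
        filter_upwards [Measure.rnDeriv_le_one_of_le h] with x hx using add_tsub_cancel_of_le hx
    _ = nu := withDensity_one

theorem tsum_measure_preimage_iterate_eq_top (hcons : Conservative f lam) (hmu : mu ≪ lam)
    (hA : MeasurableSet A) (h0 : mu A ≠ 0) : ∑' n, mu (f^[n] ⁻¹' A) = ⊤ := by
  by_contra hsum
  refine h0 (measure_mono_null_ae ?_ (measure_limsup_atTop_eq_zero hsum))
  filter_upwards [hmu.ae_le (hcons.ae_mem_imp_frequently_image_mem hA.nullMeasurableSet)]
    with x hx hxA using mem_limsup_iff_frequently_mem.2 (hx hxA)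

theorem sum_measure_preimage_iterate_add (hf : Measurable f) (h : nu.map f + mu = nu)
    (hA : MeasurableSet A) (n : ℕ) :
    ∑ k ∈ Finset.range n, mu (f^[k] ⁻¹' A) + nu (f^[n] ⁻¹' A) = nu A := by
  induction n with
  | zero => simp
  | succ n ih =>
    have hstep : nu (f^[n + 1] ⁻¹' A) + mu (f^[n] ⁻¹' A) = nu (f^[n] ⁻¹' A) := by
      conv_rhs => rw [← h, Measure.add_apply, Measure.map_apply hf (hf.iterate n hA)]
      rw [Function.iterate_succ, preimage_comp]
    rw [Finset.sum_range_succ, add_assoc, add_comm (mu _), hstep, ih]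

theorem map_eq_of_map_le [SigmaFinite nu] (hcons : Conservative f lam) (hnu : nu ≪ lam)
    (hle : nu.map f ≤ nu) : nu.map f = nu := by
  obtain ⟨d, hd⟩ := exists_add_eq_of_le hle
  have hdlam : d ≪ lam := (Measure.absolutelyContinuous_of_le
    ((Measure.le_add_left le_rfl).trans_eq hd)).trans hnu
  have hd_null : ∀ A, MeasurableSet A → nu A < ⊤ → d A = 0 := by
    intro A hA hAfin
    by_contra h0
    have hsum_le : ∑' n, d (f^[n] ⁻¹' A) ≤ nu A := ENNReal.tsum_le_of_sum_range_le fun n =>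
      le_self_add.trans_eq (sum_measure_preimage_iterate_add hcons.measurable hd hA n)
    have hsum_top := tsum_measure_preimage_iterate_eq_top hcons hdlam hA h0
    exact hsum_le.not_gt (hAfin.trans_eq hsum_top.symm)
  have hd0 : d = 0 := by
    rw [← Measure.measure_univ_eq_zero, ← iUnion_spanningSets nu, measure_iUnion_null_iff]
    exact fun n => hd_null _ (measurableSet_spanningSets nu n) (measure_spanningSets_lt_top nu n)
  simpa only [hd0, add_zero] using hd

end Superinvariant

section DiscountedSum

/-- The discounted sum `∑ n, tⁿ • fⁿ_* mu` of the push-forwards of `mu`. It replaces the usual sum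
over the first `N` iterates, because it is superinvariant up to the factor `t`, without error
term. -/
noncomputable def discountedSum (mu : Measure X) (f : X → X) (t : ℝ≥0∞) : Measure X :=
  Measure.sum fun n => t ^ n • mu.map f^[n]

theorem discountedSum_apply (hf : Measurable f) (hA : MeasurableSet A) :
    discountedSum mu f t A = ∑' n, t ^ n * mu (f^[n] ⁻¹' A) := by
  simp [discountedSum, Measure.sum_apply _ hA, Measure.map_apply (hf.iterate _) hA]

theorem le_discountedSum : mu ≤ discountedSum mu f t := by
  simpa [discountedSum] using Measure.le_sum (fun n => t ^ n • mu.map f^[n]) 0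

theorem discountedSum_apply_ne_top [IsFiniteMeasure mu] (hf : Measurable f) (ht : t < 1)
    (hA : MeasurableSet A) : discountedSum mu f t A ≠ ⊤ := by
  rw [discountedSum_apply hf hA]
  refine ne_top_of_le_ne_top (b := (1 - t)⁻¹ * mu univ) ?_ ?_
  · have : 1 - t ≠ 0 := (tsub_pos_of_lt ht).ne'
    finiteness
  · rw [← ENNReal.tsum_geometric, ← ENNReal.tsum_mul_right]
    gcongr
    exact subset_univ _

theorem discountedSum_absolutelyContinuous (hf : Measure.QuasiMeasurePreserving f mu mu) :
    discountedSum mu f t ≪ mu :=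
  Measure.absolutelyContinuous_sum_left fun n =>
    Measure.smul_absolutelyContinuous.trans (hf.iterate n).absolutelyContinuous

theorem smul_map_discountedSum_le (hf : Measurable f) :
    t • (discountedSum mu f t).map f ≤ discountedSum mu f t := by
  refine Measure.le_iff.2 fun A hA => ?_
  calc (t • (discountedSum mu f t).map f) A
      = ∑' n, t ^ (n + 1) * mu (f^[n + 1] ⁻¹' A) := by
        simp only [Measure.smul_apply, smul_eq_mul, Measure.map_apply hf hA,
          discountedSum_apply hf (hf hA), ← ENNReal.tsum_mul_left, Function.iterate_succ',
          preimage_comp, pow_succ', mul_assoc]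
    _ ≤ ∑' n, t ^ n * mu (f^[n] ⁻¹' A) :=
        ENNReal.tsum_comp_le_tsum_of_injective (add_left_injective 1) _
    _ = discountedSum mu f t A := (discountedSum_apply hf hA).symm

/-- The discounted sum of the push-forwards of `mu`, scaled so that `I` has mass `1`. -/
noncomputable def normalizedDiscountedSum (mu : Measure X) (f : X → X) (I : Set X) (t : ℝ≥0∞) :
    Measure X :=
  (discountedSum mu f t I)⁻¹ • discountedSum mu f t

theorem normalizedDiscountedSum_self [IsFiniteMeasure mu] (hf : Measurable f) (ht : t < 1)
    (hI : MeasurableSet I) (h0 : mu I ≠ 0) : normalizedDiscountedSum mu f I t I = 1 :=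
  ENNReal.inv_mul_cancel (ne_bot_of_le_ne_bot h0 (le_discountedSum I))
    (discountedSum_apply_ne_top hf ht hI)

theorem smul_map_normalizedDiscountedSum_le (hf : Measurable f) :
    t • (normalizedDiscountedSum mu f I t).map f ≤ normalizedDiscountedSum mu f I t := by
  rw [normalizedDiscountedSum, Measure.map_smul, smul_comm]
  gcongr
  exact smul_map_discountedSum_le hf

theorem normalizedDiscountedSum_absolutelyContinuous
    (hf : Measure.QuasiMeasurePreserving f mu mu) : normalizedDiscountedSum mu f I t ≪ mu :=
  Measure.smul_absolutelyContinuous.trans (discountedSum_absolutelyContinuous hf)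

theorem DistortionBoundedBelow.normalizedDiscountedSum (hJ : MeasurableSet J)
    (h : ∀ n, DistortionBoundedBelow lam (mu.map f^[n]) J c) :
    DistortionBoundedBelow lam (normalizedDiscountedSum mu f I t) J c :=
  (DistortionBoundedBelow.sum hJ fun n => (h n).smul _).smul _

end DiscountedSum

theorem exists_superinvariant [IsFiniteMeasure lam] (hf : Measure.QuasiMeasurePreserving f lam lam)
    (hI : MeasurableSet I) (h0 : lam I ≠ 0) (hc : c ≠ 0)
    (hdist : ∀ n, DistortionBoundedBelow lam (lam.map f^[n]) I c) :
    ∃ nu : Measure X, nu ≪ lam ∧ nu.map f ≤ nu ∧ nu I ≠ 0 ∧ nu I ≠ ⊤ ∧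
      ∀ J c', MeasurableSet J → (∀ n, DistortionBoundedBelow lam (lam.map f^[n]) J c') →
        DistortionBoundedBelow lam nu J c' := by
  obtain ⟨t, -, ht, ht_lim⟩ := exists_seq_strictMono_tendsto' (zero_lt_one' ℝ≥0∞)
  let m : ℕ → Measure X := fun k => normalizedDiscountedSum lam f I (t k)
  have hmI : liminf (fun k => m k I) atTop = 1 := by
    simp only [m, normalizedDiscountedSum_self hf.measurable (ht _).2 hI h0, liminf_const]
  refine ⟨liminf m atTop, ?_, ?_, ?_, ?_, fun J c' hJ hJdist => ?_⟩
  · exact liminf_measure_absolutelyContinuous fun k =>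
      normalizedDiscountedSum_absolutelyContinuous hf
  · exact map_liminf_le hf.measurable ht_lim fun k =>
      smul_map_normalizedDiscountedSum_le hf.measurable
  · have hlow := smul_restrict_le_liminf
      (fun k => DistortionBoundedBelow.normalizedDiscountedSum (I := I) (t := t k) hI hdist) I
    rw [hmI] at hlow
    refine ne_bot_of_le_ne_bot ?_ hlow
    simp [hc, h0]
  · exact ne_top_of_le_ne_top ENNReal.one_ne_top ((liminf_measure_apply_le m hI).trans_eq hmI)
  · exact .liminf hJ fun k => .normalizedDiscountedSum hJ hJdist

section Visits

theorem ae_exists_iterate_mem (hcons : Conservative f lam) (herg : PreErgodic f lam)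
    (hA : MeasurableSet A) (h0 : lam A ≠ 0) : ∀ᵐ x ∂lam, ∃ n, f^[n] x ∈ A := by
  let L : Set X := limsup (fun n => f^[n] ⁻¹' A) atTop
  have hL_mem : ∀ x, x ∈ L ↔ ∃ᶠ n in atTop, f^[n] x ∈ A := fun x => mem_limsup_iff_frequently_mem
  have hL : MeasurableSet L :=
    MeasurableSet.measurableSet_limsup fun n => hcons.measurable.iterate n hA
  have hL_inv : f ⁻¹' L = L := by
    ext x
    rw [mem_preimage, hL_mem, hL_mem]
    conv_rhs => rw [← map_add_atTop_eq_nat 1, frequently_map]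
    rfl
  rcases herg.ae_mem_or_ae_notMem hL hL_inv with h | h
  · filter_upwards [h] with x hx using ((hL_mem x).1 hx).exists
  · refine absurd (measure_eq_zero_iff_ae_notMem.2 ?_) h0
    filter_upwards [h, hcons.ae_mem_imp_frequently_image_mem hA.nullMeasurableSet]
      with x hxL hxA hx using hxL ((hL_mem x).2 (hxA hx))

theorem exists_measure_preimage_iterate_inter_ne_zero (hcons : Conservative f lam)
    (herg : PreErgodic f lam) (hI : MeasurableSet I) (hI0 : lam I ≠ 0) (hJ0 : lam J ≠ 0) :
    ∃ k, lam (f^[k] ⁻¹' I ∩ J) ≠ 0 := by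
  by_contra! hnull
  refine hJ0 (measure_mono_null_ae ?_ (measure_iUnion_null hnull))
  filter_upwards [ae_exists_iterate_mem hcons herg hI hI0] with x ⟨k, hk⟩ hxJ
  exact mem_iUnion.2 ⟨k, hk, hxJ⟩

end Visits

end Acim

theorem theorem2p9_general {X : Type*} [MeasurableSpace X] (lam : Measure X) [IsFiniteMeasure lam]
    [NeZero lam] (f : X → X) (herg : PreErgodic f lam) (hcons : Conservative f lam)
    (G : Set (Set X)) (hcount : G.Countable) (hmeas : ∀ I ∈ G, MeasurableSet I)
    (hcover : lam (⋃₀ G)ᶜ = 0)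
    (hdist : ∀ I ∈ G, ∃ c ≠ 0, ∀ n, Acim.DistortionBoundedBelow lam (lam.map f^[n]) I c) :
    ∃ nu : Measure X, SigmaFinite nu ∧ nu ≠ 0 ∧ nu ≪ lam ∧ MeasurePreserving f nu nu := by
  obtain ⟨I, hIG, hI0⟩ : ∃ I ∈ G, lam I ≠ 0 := by
    by_contra! hnull
    refine NeZero.ne lam (Measure.measure_univ_eq_zero.1 ?_)
    rw [← union_compl_self (⋃₀ G)]
    exact measure_union_null ((measure_sUnion_null_iff hcount).2 hnull) hcover
  obtain ⟨c, hc, hIdist⟩ := hdist I hIG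
  obtain ⟨nu, hac, hle, hnuI, hnuI_top, hnu⟩ := Acim.exists_superinvariant
    hcons.toQuasiMeasurePreserving (hmeas I hIG) hI0 hc hIdist
  have hfinite : ∀ J ∈ G, nu J < ⊤ := by
    intro J hJG
    rcases eq_or_ne (lam J) 0 with hJ0 | hJ0
    · simp [hac hJ0]
    obtain ⟨c', hc', hJdist⟩ := hdist J hJG
    obtain ⟨k, hk⟩ := Acim.exists_measure_preimage_iterate_inter_ne_zero hcons herg
      (hmeas I hIG) hI0 hJ0
    exact ((hnu J c' (hmeas J hJG) hJdist).measure_ne_top hcons.measurable hle hc'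
      (hmeas I hIG) hnuI_top hk).lt_top
  have : SigmaFinite nu := by
    refine Measure.sigmaFinite_of_countable (hcount.insert (⋃₀ G)ᶜ) ?_ ?_
    · exact forall_mem_insert.2 ⟨by simp [hac hcover], hfinite⟩
    · rw [sUnion_insert, compl_union_self]
  exact ⟨nu, this, fun h => hnuI (by simp [h]), hac, hcons.measurable,
    Acim.map_eq_of_map_le hcons hac hle⟩

theorem theorem2p9 {X : Type*} [TopologicalSpace X] [SigmaCompactSpace X]
    [MeasurableSpace X] [BorelSpace X]
    (lam : MeasureTheory.Measure X) [MeasureTheory.IsProbabilityMeasure lam]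
    (f : X → X) (hf : Measurable f) (hqi : (lam.map f).AbsolutelyContinuous lam)
    (herg : QuasiErgodic f lam) (hcons : MeasureTheory.Conservative f lam)
    (hG : ∃ G : Set (Set X), Acim.IsLambdaPartition lam G ∧ lam ∈ Acim.measureClass lam G f) :
    ∃ nu : MeasureTheory.Measure X, MeasureTheory.SigmaFinite nu ∧ nu ≠ 0 ∧
      nu.AbsolutelyContinuous lam ∧ MeasureTheory.MeasurePreserving f nu nu := by
  obtain ⟨G, hpart, -, hM⟩ := hG
  exact theorem2p9_general lam f herg.toPreErgodic hcons G hpart.countable hpart.measurableSet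
    hpart.null_compl fun I hI =>
      let ⟨_, hK, _, hdist⟩ := hM I hI
      hdist.exists_distortionBoundedBelow (hpart.measurableSet I hI) (hpart.pos I hI).ne' hK
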